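/- Fix an o-minimal structure on $\mathbb{R}$ containing all semialgebraic sets. For a definable set $X\subseteq\mathbb{R}^n$ let $\chi(X)=\sum_{C}(-1)^{\dim C}$ be its combinatorial Euler characteristic, the sum being over the cells $C$ of any finite partition of $X$ into definable cells (the value does not depend on the partition, and $\chi(\varnothing)=0$). For a compactly supported definable function $f:\mathbb{R}^d\to\mathbb{R}$, a direction $\nu\in S^{d-1}$ and $h,t\in\mathbb{R}$ put $$\operatorname{SELECT}(f)(\nu,h,t)=\chi\big(\{x\in\mathbb{R}^d \mid x\cdot\nu\le h,\ f(x)\ge t\}\big),\qquad M_\nu^f(h)=\int_{\mathbb{R}}\operatorname{SELECT}(f)(\nu,h,t)\,dt ;$$ $M_\nu^f$ is the marginal Euler curve of $f$ in direction $\nu$. A weighted simplicial complex $(K,g)$ in $\mathbb{R}^d$ is a finite Euclidean simplicial complex $K$ together with a weight $g(\sigma)\in\mathbb{N}=\{0,1,2,\dots\}$ for each simplex $\sigma$ of $K$, such that $g(\tau)=\max\{g(\sigma)\mid \sigma\in K,\ \tau \text{ a proper face of } \sigma\}$ whenever $\tau$ is a proper face of some simplex of $K$. It defines the function $f_g:\mathbb{R}^d\to\mathbb{R}$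 that is constant, equal to $g(\sigma)$, on the open simplex of each $\sigma\in K$, and zero outside $K$. The weighted Euler curve of $(K,g)$ in direction $\nu$ is $$\chi^w_\nu(h)=\sum_{\sigma\in K,\ \sigma\subseteq\{x\cdot\nu\le h\}}(-1)^{\dim\sigma}\,g(\sigma),$$ the weighted Euler characteristic of the subcomplex of the simplices of $K$ that lie in the half-space $\{x\cdot\nu\le h\}$. Proposition. Let $(K,g)$ be a weighted simplicial complex in $\mathbb{R}^d$. Then for every direction $\nu\in S^{d-1}$ and every height $h\in\mathbb{R}$ the function $t\mapsto\operatorname{SELECT}(f_g)(\nu,h,t)$ is Lebesgue integrable on $\mathbb{R}$, and $$M_\nu^{f_g}(h)=\chi^w_\nu(h).$$ -/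

import Mathlib

noncomputable section

namespace Select

/-! ### O-minimal structures over the real field -/

/-- Semialgebraic subsets of `ℝⁿ`: the Boolean combinations of sets `{x | 0 < p x}`, with `p` a
real polynomial. -/
inductive IsSemialgebraic {n : ℕ} : Set (Fin n → ℝ) → Prop
  | pos (p : MvPolynomial (Fin n) ℝ) : IsSemialgebraic {x | 0 < MvPolynomial.eval x p}
  | inter {A B : Set (Fin n → ℝ)} :
      IsSemialgebraic A → IsSemialgebraic B → IsSemialgebraic (A ∩ B)
  | compl {A : Set (Fin n → ℝ)} : IsSemialgebraic A → IsSemialgebraic Aᶜ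

/-- An o-minimal structure on `ℝ`. `Def n` is the collection of definable subsets of `ℝⁿ`. -/
structure OMinimalStructure where
  Def : (n : ℕ) → Set (Set (Fin n → ℝ))
  inter_mem : ∀ {n : ℕ} {A B : Set (Fin n → ℝ)}, A ∈ Def n → B ∈ Def n → A ∩ B ∈ Def n
  compl_mem : ∀ {n : ℕ} {A : Set (Fin n → ℝ)}, A ∈ Def n → Aᶜ ∈ Def n
  /-- `A × ℝ` is definable. -/
  prod_right : ∀ {n : ℕ} {A : Set (Fin n → ℝ)}, A ∈ Def n →
    {z : Fin (n + 1) → ℝ | Fin.init z ∈ A} ∈ Def (n + 1)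
  /-- `ℝ × A` is definable. -/
  prod_left : ∀ {n : ℕ} {A : Set (Fin n → ℝ)}, A ∈ Def n →
    {z : Fin (n + 1) → ℝ | Fin.tail z ∈ A} ∈ Def (n + 1)
  /-- Axis-aligned projections (forgetting the `i`-th coordinate) preserve definability. -/
  proj_mem : ∀ {n : ℕ} {A : Set (Fin (n + 1) → ℝ)} (i : Fin (n + 1)), A ∈ Def (n + 1) →
    (fun z : Fin (n + 1) → ℝ => Fin.removeNth i z) '' A ∈ Def n
  semialgebraic_mem : ∀ {n : ℕ} {A : Set (Fin n → ℝ)}, IsSemialgebraic A → A ∈ Def n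
  /-- The definable subsets of the line are finite unions of points and of (possibly unbounded)
  open intervals. -/
  line : ∀ {A : Set (Fin 1 → ℝ)}, A ∈ Def 1 →
    ∃ F : Set (Set ℝ), F.Finite ∧
      (∀ I ∈ F, (∃ a : ℝ, I = {a}) ∨ (IsOpen I ∧ I.OrdConnected)) ∧
      A = {x | x 0 ∈ ⋃₀ F}

/-! ### Cells and the Euler characteristic -/

/-- `φ : B → ℝ` is definable (its graph is a definable set) and continuous. -/
def IsDefinableContinuousOn (O : OMinimalStructure) {n : ℕ} (φ : (Fin n → ℝ) → ℝ)
    (B : Set (Fin n → ℝ)) : Prop :=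
  {z : Fin (n + 1) → ℝ | Fin.init z ∈ B ∧ z (Fin.last n) = φ (Fin.init z)} ∈ O.Def (n + 1) ∧
    ContinuousOn φ B

/-- The functions that may bound a band over `B`: the definable continuous functions `B → ℝ`
and the two constant functions `-∞` and `+∞`. -/
def IsBandBound (O : OMinimalStructure) {n : ℕ} (f : (Fin n → ℝ) → EReal)
    (B : Set (Fin n → ℝ)) : Prop :=
  (∀ y ∈ B, f y = ⊥) ∨ (∀ y ∈ B, f y = ⊤) ∨
    ∃ φ : (Fin n → ℝ) → ℝ, IsDefinableContinuousOn O φ B ∧ ∀ y ∈ B, f y = (φ y : EReal)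

/-- `IsCell O n k C`: `C ⊆ ℝⁿ` is a cell of dimension `k` of the o-minimal structure `O`. The cells
of `ℝⁿ⁺¹` are the graphs of definable continuous functions on cells of `ℝⁿ`, and the bands
`{(y, s) | y ∈ B, f y < s < g y}` over cells `B` of `ℝⁿ`. -/
inductive IsCell (O : OMinimalStructure) : (n : ℕ) → ℕ → Set (Fin n → ℝ) → Prop
  | point : IsCell O 0 0 Set.univ
  | graph {n k : ℕ} {B : Set (Fin n → ℝ)} (φ : (Fin n → ℝ) → ℝ) :
      IsCell O n k B → IsDefinableContinuousOn O φ B →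
      IsCell O (n + 1) k {z | Fin.init z ∈ B ∧ z (Fin.last n) = φ (Fin.init z)}
  | band {n k : ℕ} {B : Set (Fin n → ℝ)} (f g : (Fin n → ℝ) → EReal) :
      IsCell O n k B → IsBandBound O f B → IsBandBound O g B → (∀ y ∈ B, f y < g y) →
      IsCell O (n + 1) (k + 1)
        {z | Fin.init z ∈ B ∧ f (Fin.init z) < (z (Fin.last n) : EReal) ∧
          (z (Fin.last n) : EReal) < g (Fin.init z)}

/-- `X` is partitioned into finitely many cells `C i`, and `e = ∑ᵢ (-1) ^ dim (C i)`. -/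
def HasEulerChar (O : OMinimalStructure) {n : ℕ} (X : Set (Fin n → ℝ)) (e : ℤ) : Prop :=
  ∃ (m : ℕ) (C : Fin m → Set (Fin n → ℝ)) (k : Fin m → ℕ),
    (∀ i, IsCell O n (k i) (C i)) ∧ (∀ i j, i ≠ j → Disjoint (C i) (C j)) ∧
      (⋃ i, C i) = X ∧ e = ∑ i, (-1 : ℤ) ^ k i

/-! The Euler characteristic is well defined. -/

/-- Auxiliary: `φ : ℝ → ℤ` has right limits `R` everywhere and a limit `N` at `-∞`, and the sum of
its right jumps, minus `N`, is `ε`. -/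
def LineEuler (φ : ℝ → ℤ) (ε : ℤ) : Prop :=
  ∃ (R : ℝ → ℤ) (N : ℤ) (P : Finset ℝ),
    (∀ x, ∀ᶠ x' in nhdsWithin x (Set.Ioi x), φ x' = R x) ∧ (∀ᶠ x in Filter.atBot, φ x = N) ∧
      ∀ Q : Finset ℝ, P ⊆ Q → ∑ x ∈ Q, (φ x - R x) - N = ε

theorem LineEuler.zero : LineEuler (fun _ => 0) 0 :=
  ⟨fun _ => 0, 0, ∅, by simp, by simp, by simp⟩

theorem LineEuler.add_smul {φ ψ : ℝ → ℤ} {ε δ : ℤ} (c : ℤ) (hφ : LineEuler φ ε)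
    (hψ : LineEuler ψ δ) : LineEuler (fun x => c * φ x + ψ x) (c * ε + δ) := by
  classical
  obtain ⟨R, N, P, h1, h2, h3⟩ := hφ
  obtain ⟨R', N', P', h1', h2', h3'⟩ := hψ
  refine ⟨fun x => c * R x + R' x, c * N + N', P ∪ P', fun x => ?_, ?_, fun Q hQ => ?_⟩
  · filter_upwards [h1 x, h1' x] with y hy hy'
    rw [hy, hy']
  · filter_upwards [h2, h2'] with y hy hy'
    rw [hy, hy']
  · rw [← h3 Q (Finset.union_subset_left hQ), ← h3' Q (Finset.union_subset_right hQ), mul_sub,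
      Finset.mul_sum]
    have : ∑ x ∈ Q, (c * φ x + ψ x - (c * R x + R' x)) =
        ∑ x ∈ Q, c * (φ x - R x) + ∑ x ∈ Q, (ψ x - R' x) := by
      rw [← Finset.sum_add_distrib]
      exact Finset.sum_congr rfl fun x _ => by ring
    rw [this]; ring

theorem LineEuler.sum {ι : Type*} (s : Finset ι) (c : ι → ℤ) (φ : ι → ℝ → ℤ) (ε : ι → ℤ)
    (h : ∀ i ∈ s, LineEuler (φ i) (ε i)) :
    LineEuler (fun x => ∑ i ∈ s, c i * φ i x) (∑ i ∈ s, c i * ε i) := by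
  classical
  induction s using Finset.induction_on with
  | empty => simpa using LineEuler.zero
  | insert a s ha ih =>
    simp only [Finset.sum_insert ha]
    exact LineEuler.add_smul (c a) (h a (Finset.mem_insert_self a s))
      (ih fun i hi => h i (Finset.mem_insert_of_mem hi))

theorem LineEuler.eq_zero {ε : ℤ} (h : LineEuler (fun _ => 0) ε) : ε = 0 := by
  obtain ⟨R, N, P, h1, h2, h3⟩ := h
  have hR : ∀ x, R x = 0 := fun x => by
    obtain ⟨y, hy⟩ := (h1 x).exists
    exact hy.symm
  obtain ⟨y, hy⟩ := h2.exists
  have := h3 P (Finset.Subset.refl P)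
  simp [hR, ← hy] at this
  exact this.symm

theorem LineEuler.singleton (a : ℝ) : LineEuler (Set.indicator {a} fun _ => 1) 1 := by
  classical
  refine ⟨fun _ => 0, 0, {a}, fun x => ?_, ?_, fun Q hQ => ?_⟩
  · rcases lt_or_ge x a with hx | hx
    · filter_upwards [Ioo_mem_nhdsGT hx] with y hy
      simp [hy.2.ne]
    · filter_upwards [self_mem_nhdsWithin] with y hy
      have : y ≠ a := (lt_of_le_of_lt hx hy).ne'
      simp [this]
  · filter_upwards [Filter.eventually_lt_atBot a] with y hy
    simp [hy.ne]
  · have ha : a ∈ Q := hQ (Finset.mem_singleton_self a)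
    simp [Set.indicator_apply, ha]

theorem LineEuler.interval (a b : EReal) (hab : a < b) :
    LineEuler (Set.indicator {s : ℝ | a < (s : EReal) ∧ (s : EReal) < b} fun _ => 1) (-1) := by
  classical
  refine ⟨fun x => if a ≤ (x : EReal) ∧ (x : EReal) < b then 1 else 0, if a = ⊥ then 1 else 0,
    {a.toReal}, fun x => ?_, ?_, fun Q hQ => ?_⟩
  · by_cases hb : (x : EReal) < b
    · have hb' : ∀ᶠ y : ℝ in nhdsWithin x (Set.Ioi x), (y : EReal) < b :=
        (continuous_coe_real_ereal.continuousAt.eventually (gt_mem_nhds hb)).filter_mono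
          nhdsWithin_le_nhds
      by_cases ha : a ≤ (x : EReal)
      · filter_upwards [hb', self_mem_nhdsWithin] with y hy hxy
        have : a < (y : EReal) := lt_of_le_of_lt ha (EReal.coe_lt_coe_iff.2 hxy)
        simp [hy, ha, hb, this]
      · have ha' : ∀ᶠ y : ℝ in nhdsWithin x (Set.Ioi x), (y : EReal) < a :=
          (continuous_coe_real_ereal.continuousAt.eventually
            (gt_mem_nhds (not_le.1 ha))).filter_mono nhdsWithin_le_nhds
        filter_upwards [ha'] with y hy
        simp [ha, hy.le]
    · filter_upwards [self_mem_nhdsWithin] with y hxy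
      have : ¬ (y : EReal) < b :=
        not_lt.2 ((not_lt.1 hb).trans (EReal.coe_lt_coe_iff.2 hxy).le)
      simp [hb, this]
  · induction a with
    | bot =>
      induction b with
      | bot => simp at hab
      | coe b =>
        filter_upwards [Filter.eventually_lt_atBot b] with y hy
        simp [hy]
      | top => simp
    | coe a =>
      filter_upwards [Filter.eventually_lt_atBot a] with y hy
      simp [hy.le]
    | top => simp at hab
  · have key : ∀ x : ℝ, Set.indicator {s : ℝ | a < (s : EReal) ∧ (s : EReal) < b} (fun _ => (1 : ℤ)) x
        - (if a ≤ (x : EReal) ∧ (x : EReal) < b then 1 else 0) = if a = (x : EReal) then -1 else 0 := by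
      intro x
      simp only [Set.indicator_apply, Set.mem_ofPred_eq]
      rcases lt_trichotomy a (x : EReal) with h | h | h
      · simp [h, h.le, h.ne]
      · subst h; simp [hab]
      · simp [not_lt.2 h.le, not_le.2 h, h.ne']
    simp only [key]
    induction a with
    | bot => simp
    | coe a =>
      have : a ∈ Q := by simpa using hQ
      simp [this]
    | top => simp at hab

/-- The decomposition of a cell over its base: fibrewise, it is a point or an interval. -/
theorem IsCell.fibre {O : OMinimalStructure} {n k : ℕ} {C : Set (Fin (n + 1) → ℝ)}
    (h : IsCell O (n + 1) k C) : ∃ (B : Set (Fin n → ℝ)) (j : ℕ) (ε : ℤ), IsCell O n j B ∧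
      (-1 : ℤ) ^ k = ε * (-1) ^ j ∧
      ∀ y, LineEuler (fun s => C.indicator (fun _ => 1) (Fin.snoc y s : Fin (n + 1) → ℝ))
        (ε * B.indicator (fun _ => 1) y) := by
  classical
  cases h with
  | @graph n k B φ hB hφ =>
    refine ⟨B, k, 1, hB, by simp, fun y => ?_⟩
    by_cases hy : y ∈ B
    · convert LineEuler.singleton (φ y) using 1
      · ext s; simp [Set.indicator_apply, hy]
      · simp [hy]
    · convert LineEuler.zero using 1
      · ext s; simp [hy]
      · simp [hy]
  | @band n k B f g hB hf hg hfg =>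
    refine ⟨B, k, -1, hB, by rw [pow_succ, mul_comm], fun y => ?_⟩
    by_cases hy : y ∈ B
    · convert LineEuler.interval (f y) (g y) (hfg y hy) using 1
      · ext s; simp [Set.indicator_apply, hy]
      · simp [hy]
    · convert LineEuler.zero using 1
      · ext s; simp [hy]
      · simp [hy]

theorem IsCell.sum_eq_zero {O : OMinimalStructure} {n : ℕ} {ι : Type*} (s : Finset ι) (c : ι → ℤ)
    (C : ι → Set (Fin n → ℝ)) (k : ι → ℕ) (hC : ∀ i, IsCell O n (k i) (C i))
    (h : ∀ x, ∑ i ∈ s, c i * (C i).indicator (fun _ => 1) x = 0) :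
    ∑ i ∈ s, c i * (-1) ^ k i = 0 := by
  induction n generalizing c k with
  | zero =>
    rw [← h ![]]
    refine Finset.sum_congr rfl fun i _ => ?_
    have : k i = 0 ∧ C i = Set.univ := by
      generalize k i = m, C i = D, hC i = hD
      cases hD
      exact ⟨rfl, rfl⟩
    simp [this]
  | succ n ih =>
    choose B j ε hB hk hL using fun i => (hC i).fibre
    have := ih (fun i => c i * ε i) B j hB fun y => by
      have h1 := LineEuler.sum s c _ _ fun i _ => hL i y
      simp only [h] at h1
      rw [← h1.eq_zero]
      exact Finset.sum_congr rfl fun i _ => by ring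
    rw [← this]
    exact Finset.sum_congr rfl fun i _ => by rw [hk]; ring

/-- The alternating sum of a finite partition into cells does not depend on the partition. -/
theorem HasEulerChar.unique {O : OMinimalStructure} {n : ℕ} {X : Set (Fin n → ℝ)} {e e' : ℤ}
    (h : HasEulerChar O X e) (h' : HasEulerChar O X e') : e = e' := by
  classical
  obtain ⟨m, C, k, hC, hd, hX, rfl⟩ := h
  obtain ⟨m', C', k', hC', hd', hX', rfl⟩ := h'
  have key : ∀ {m : ℕ} {C : Fin m → Set (Fin n → ℝ)}, (∀ i j, i ≠ j → Disjoint (C i) (C j)) →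
      (⋃ i, C i) = X → ∀ x, ∑ i, (C i).indicator (fun _ => (1 : ℤ)) x =
        X.indicator (fun _ => 1) x := by
    intro m C hd hX x
    rw [← hX]
    by_cases hx : x ∈ ⋃ i, C i
    · obtain ⟨i, hi⟩ := Set.mem_iUnion.1 hx
      rw [Set.indicator_of_mem hx, Finset.sum_eq_single i, Set.indicator_of_mem hi]
      · intro j _ hj
        exact Set.indicator_of_notMem (Set.disjoint_left.1 (hd i j hj.symm) hi) _
      · simp
    · rw [Set.indicator_of_notMem hx]
      refine Finset.sum_eq_zero fun i _ => Set.indicator_of_notMem (fun hi => hx ?_) _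
      exact Set.mem_iUnion.2 ⟨i, hi⟩
  have := IsCell.sum_eq_zero (O := O) (Finset.univ : Finset (Fin m ⊕ Fin m'))
    (Sum.elim (fun _ => 1) fun _ => -1) (Sum.elim C C') (Sum.elim k k')
    (fun i => by cases i <;> simp [hC, hC'])
    (fun x => by
      simp only [Fintype.sum_sum_type, Sum.elim_inl, Sum.elim_inr, one_mul, neg_mul,
        Finset.sum_neg_distrib]
      rw [key hd hX x, key hd' hX' x, add_neg_cancel])
  simp only [Fintype.sum_sum_type, Sum.elim_inl, Sum.elim_inr, one_mul, neg_mul,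
        Finset.sum_neg_distrib] at this
  linarith

open Classical in
/-- The (combinatorial) Euler characteristic of a definable set: `∑ (-1) ^ dim C`, over the cells
`C` of any finite partition of the set into cells. The value does not depend on the partition. -/
def eulerChar (O : OMinimalStructure) {n : ℕ} (X : Set (Fin n → ℝ)) : ℤ :=
  if h : ∃ e : ℤ, HasEulerChar O X e then h.choose else 0

theorem HasEulerChar.eulerChar_eq {O : OMinimalStructure} {n : ℕ} {X : Set (Fin n → ℝ)} {e : ℤ}
    (h : HasEulerChar O X e) : eulerChar O X = e := by
  have hex : ∃ e : ℤ, HasEulerChar O X e := ⟨e, h⟩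
  rw [eulerChar, dif_pos hex]
  exact hex.choose_spec.unique h

/-! ### The super lifted Euler characteristic transform and its marginals -/

/-- `SELECT(f)(v, h, t) = χ {x | x · v ≤ h, f x ≥ t}`. The set is read in coordinates. -/
def select (O : OMinimalStructure) {d : ℕ} (f : EuclideanSpace ℝ (Fin d) → ℝ)
    (v : EuclideanSpace ℝ (Fin d)) (h t : ℝ) : ℤ :=
  eulerChar O {y : Fin d → ℝ | inner ℝ (WithLp.toLp 2 y) v ≤ h ∧ t ≤ f (WithLp.toLp 2 y)}

/-- The marginal Euler curve `M_v^f(h) = ∫ SELECT(f)(v, h, t) dt`. -/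
def marginalEulerCurve (O : OMinimalStructure) {d : ℕ} (f : EuclideanSpace ℝ (Fin d) → ℝ)
    (v : EuclideanSpace ℝ (Fin d)) (h : ℝ) : ℝ :=
  ∫ t : ℝ, (select O f v h t : ℝ)

/-! ### Weighted simplicial complexes -/

/-- A weighted simplicial complex in `ℝᵈ`: a finite Euclidean simplicial complex with a natural
number attached to each simplex, such that the weight of a simplex which is a proper face of
another one is the maximum of the weights of the simplices of which it is a proper face. -/
structure WeightedComplex (d : ℕ) where
  complex : Geometry.SimplicialComplex ℝ (EuclideanSpace ℝ (Fin d))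
  finite_faces : complex.faces.Finite
  /-- Only the values on `complex.faces` matter. -/
  weight : Finset (EuclideanSpace ℝ (Fin d)) → ℕ
  admissible : ∀ τ ∈ complex.faces, (∃ σ ∈ complex.faces, τ ⊂ σ) →
    IsGreatest (weight '' {σ | σ ∈ complex.faces ∧ τ ⊂ σ}) (weight τ)

/-- The open simplex with vertex set `σ`: the convex combinations of the vertices all of whose
coefficients are positive. -/
def openSimplex {d : ℕ} (σ : Finset (EuclideanSpace ℝ (Fin d))) :
    Set (EuclideanSpace ℝ (Fin d)) :=
  {x | ∃ w : EuclideanSpace ℝ (Fin d) → ℝ,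
    (∀ p ∈ σ, 0 < w p) ∧ ∑ p ∈ σ, w p = 1 ∧ ∑ p ∈ σ, w p • p = x}

/-- The field `ℝᵈ → ℝ` of a weighted simplicial complex: constant, equal to the weight of `σ`, on
the open simplex of each `σ` (these are disjoint, so at most one term of the sum is not zero), and
zero outside the complex. -/
def WeightedComplex.field {d : ℕ} (W : WeightedComplex d) (x : EuclideanSpace ℝ (Fin d)) : ℝ :=
  ∑ σ ∈ W.finite_faces.toFinset, (openSimplex σ).indicator (fun _ => (W.weight σ : ℝ)) x

/-- The sublevel complex `K ∩ {x · v ≤ r}`: the simplices of `K` all of whose vertices (hence all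
of whose points) satisfy `x · v ≤ r`. -/
def sublevelComplex {d : ℕ} (K : Geometry.SimplicialComplex ℝ (EuclideanSpace ℝ (Fin d)))
    (v : EuclideanSpace ℝ (Fin d)) (r : ℝ) :
    Geometry.SimplicialComplex ℝ (EuclideanSpace ℝ (Fin d)) where
  faces := {σ | σ ∈ K.faces ∧ ∀ p ∈ σ, inner ℝ p v ≤ r}
  isRelLowerSet_faces := fun _ hs =>
    ⟨K.nonempty_of_mem_faces hs.1, fun _ hts ht =>
      ⟨K.down_closed hs.1 hts ht, fun p hp => hs.2 p (hts hp)⟩⟩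
  indep := fun hs => K.indep hs.1
  inter_subset_convexHull := fun hs ht => K.inter_subset_convexHull hs.1 ht.1

/-- The weighted Euler characteristic `∑_σ (-1) ^ dim σ * g σ` of a finite simplicial complex,
where `dim σ` is the number of vertices of `σ` minus one. -/
def weightedEulerChar {d : ℕ} (K : Geometry.SimplicialComplex ℝ (EuclideanSpace ℝ (Fin d)))
    (g : Finset (EuclideanSpace ℝ (Fin d)) → ℕ) : ℤ :=
  ∑ᶠ σ ∈ K.faces, (-1 : ℤ) ^ (σ.card - 1) * (g σ : ℤ)

/-- The weighted Euler curve of a weighted simplicial complex in direction `v`. -/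
def WeightedComplex.weightedEulerCurve {d : ℕ} (W : WeightedComplex d)
    (v : EuclideanSpace ℝ (Fin d)) (r : ℝ) : ℤ :=
  weightedEulerChar (sublevelComplex W.complex v r) W.weight

end Select

end

noncomputable section

namespace Select

open Module Set

/-! ### Definable sets -/

namespace OMinimalStructure

variable (O : OMinimalStructure) {n : ℕ}

/-! For `t > 0` the set `f_g ≥ t` is the disjoint union of the open simplices of weight at least
`t`, so by additivity of χ its part in the half-space is computed one simplex at a time. If all
vertices of σ lie in the closed half-space, the whole open simplex counts and contributes `(-1) ^
dim σ`. Otherwise the contribution is 0. Either the open simplex misses the half-space, or it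
crosses the bounding hyperplane; then its open part below the hyperplane has dimension `dim σ`, its
section by the hyperplane has dimension `dim σ - 1`, and the two signs cancel
(`openPolyhedron.hasEulerChar_cut`, `hasEulerChar_openSimplex_cut`). For `t ≤ 0` the set is the full
half-space, and the same cancellation, applied to the whole space, gives 0.

Hence `t ↦ SELECT` is a finite sum of step functions, one for each σ, supported on `(0, g σ]`
(`select_field`). It is integrable, and each step integrates to `g σ` times its height.

Since χ is defined by cells, the geometric input is `openPolyhedron.isCell`: a nonempty relatively
open polyhedron is a single cell whose dimension is that of its affine subspace. It is proved by
eliminating the last coordinate. Open simplices are such polyhedra, cut out by their barycentric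
coordinates. -/

theorem affine_pos_mem (ℓ : (Fin n → ℝ) →ᵃ[ℝ] ℝ) : {x | 0 < ℓ x} ∈ O.Def n := by
  have key : ∀ x, MvPolynomial.eval x (∑ i, MvPolynomial.C (ℓ.linear (Pi.single i 1)) *
      MvPolynomial.X i + MvPolynomial.C (ℓ 0)) = ℓ x := fun x => by
    have h1 : ℓ x = ℓ.linear x + ℓ 0 := congrFun (AffineMap.decomp ℓ) x
    have h2 := map_sum ℓ.linear (fun i => Pi.single i (x i)) Finset.univ
    rw [Finset.univ_sum_single] at h2
    rw [h1, h2]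
    simp only [map_add, map_sum, map_mul, MvPolynomial.eval_C, MvPolynomial.eval_X]
    refine congrArg (· + ℓ 0) (Finset.sum_congr rfl fun i _ => ?_)
    rw [mul_comm, ← smul_eq_mul, ← map_smul, ← Pi.single_smul, smul_eq_mul, mul_one]
  have := O.semialgebraic_mem (IsSemialgebraic.pos (∑ i, MvPolynomial.C
    (ℓ.linear (Pi.single i 1)) * MvPolynomial.X i + MvPolynomial.C (ℓ 0)))
  simpa only [key] using this

theorem affine_nonneg_mem (ℓ : (Fin n → ℝ) →ᵃ[ℝ] ℝ) : {x | 0 ≤ ℓ x} ∈ O.Def n := by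
  convert O.compl_mem (O.affine_pos_mem (-ℓ)) using 1
  ext x; simp

theorem affine_eq_zero_mem (ℓ : (Fin n → ℝ) →ᵃ[ℝ] ℝ) : {x | ℓ x = 0} ∈ O.Def n := by
  convert O.inter_mem (O.affine_nonneg_mem ℓ) (O.affine_nonneg_mem (-ℓ)) using 1
  ext x; simp [le_antisymm_iff, and_comm]

theorem univ_mem : (univ : Set (Fin n → ℝ)) ∈ O.Def n := by
  convert O.affine_eq_zero_mem (0 : (Fin n → ℝ) →ᵃ[ℝ] ℝ) using 1
  ext x; simp

theorem iInter_mem {ι : Type*} [Finite ι] {A : ι → Set (Fin n → ℝ)} (hA : ∀ i, A i ∈ O.Def n) :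
    ⋂ i, A i ∈ O.Def n := by
  classical
  have := Fintype.ofFinite ι
  have : ∀ s : Finset ι, ⋂ i ∈ s, A i ∈ O.Def n := fun s => by
    induction s using Finset.induction_on with
    | empty => simpa using O.univ_mem
    | insert a s _ ih =>
      rw [Finset.set_biInter_insert]
      exact O.inter_mem (hA a) ih
  simpa using this Finset.univ

theorem iUnion_mem {ι : Type*} [Finite ι] {A : ι → Set (Fin n → ℝ)} (hA : ∀ i, A i ∈ O.Def n) :
    ⋃ i, A i ∈ O.Def n := by
  rw [← compl_compl (⋃ i, A i), compl_iUnion]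
  exact O.compl_mem (O.iInter_mem fun i => O.compl_mem (hA i))

theorem image_init_mem {A : Set (Fin (n + 1) → ℝ)} (hA : A ∈ O.Def (n + 1)) :
    Fin.init '' A ∈ O.Def n := by
  have := O.proj_mem (Fin.last n) hA
  simpa only [Fin.removeNth_last] using this

/-- A nonempty affine subspace is a fibre of the quotient map by its direction, so the coordinates
of the quotient give finitely many affine equations for it. -/
theorem affineSubspace_mem (A : AffineSubspace ℝ (Fin n → ℝ)) :
    (A : Set (Fin n → ℝ)) ∈ O.Def n := by
  rcases A.eq_bot_or_nonempty with rfl | ⟨x₀, hx₀⟩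
  · simpa using O.compl_mem O.univ_mem
  · let b := Module.finBasis ℝ ((Fin n → ℝ) ⧸ A.direction)
    let ℓ : (Fin n → ℝ) →ₗ[ℝ] _ := A.direction.mkQ
    convert O.iInter_mem fun i => O.affine_eq_zero_mem
      (((b.coord i).comp ℓ).toAffineMap - AffineMap.const ℝ _ (b.coord i (ℓ x₀))) using 1
    ext x
    have h1 : x ∈ A ↔ ℓ (x - x₀) = 0 := by
      rw [← AffineSubspace.vsub_right_mem_direction_iff_mem hx₀, vsub_eq_sub]
      exact (Submodule.Quotient.mk_eq_zero _).symm
    rw [SetLike.mem_coe, h1, ← b.forall_coord_eq_zero_iff]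
    simp [map_sub]

end OMinimalStructure

/-! ### Relatively open polyhedra are cells -/


/-- The relatively open polyhedron cut out of the affine subspace `A` by the strict inequalities
`0 < ℓ i x`. -/
def openPolyhedron {n : ℕ} {ι : Type} (A : AffineSubspace ℝ (Fin n → ℝ))
    (ℓ : ι → (Fin n → ℝ) →ᵃ[ℝ] ℝ) : Set (Fin n → ℝ) :=
  {x | x ∈ A ∧ ∀ i, 0 < ℓ i x}

theorem openPolyhedron.mem_def (O : OMinimalStructure) {n : ℕ} {ι : Type} [Finite ι]
    (A : AffineSubspace ℝ (Fin n → ℝ)) (ℓ : ι → (Fin n → ℝ) →ᵃ[ℝ] ℝ) :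
    openPolyhedron A ℓ ∈ O.Def n := by
  convert O.inter_mem (O.affineSubspace_mem A) (O.iInter_mem fun i => O.affine_pos_mem (ℓ i)) using 1
  ext x; simp [openPolyhedron]

/-- Forgetting the last coordinate, as a linear map. -/
def initL (n : ℕ) : (Fin (n + 1) → ℝ) →ₗ[ℝ] (Fin n → ℝ) :=
  LinearMap.funLeft ℝ ℝ Fin.castSucc

/-- Appending a zero, as a linear map. -/
def snocZeroL (n : ℕ) : (Fin n → ℝ) →ₗ[ℝ] (Fin (n + 1) → ℝ) where
  toFun y := Fin.snoc y 0
  map_add' x y := by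
    ext i; refine Fin.lastCases ?_ (fun j => ?_) i <;> simp
  map_smul' c y := by
    ext i; refine Fin.lastCases ?_ (fun j => ?_) i <;> simp

/-- The last coordinate, as a linear functional. -/
def lastL (n : ℕ) : (Fin (n + 1) → ℝ) →ₗ[ℝ] ℝ := LinearMap.proj (Fin.last n)

/-- The last vector of the standard basis. -/
def lastVec (n : ℕ) : Fin (n + 1) → ℝ := Pi.single (Fin.last n) 1

theorem initL_apply {n : ℕ} (z : Fin (n + 1) → ℝ) : initL n z = Fin.init z := rfl

theorem snocZeroL_add {n : ℕ} (y : Fin n → ℝ) (s : ℝ) :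
    snocZeroL n y + s • lastVec n = Fin.snoc y s := by
  ext i; refine Fin.lastCases ?_ (fun j => ?_) i <;> simp [snocZeroL, lastVec]

/-- Isolates the dependence on the last coordinate: the sign of the slope `ℓ.linear (lastVec n)`
decides whether `0 < ℓ` bounds the height from below, from above, or only constrains the base. -/
theorem apply_snoc {n : ℕ} (ℓ : (Fin (n + 1) → ℝ) →ᵃ[ℝ] ℝ) (y : Fin n → ℝ) (s : ℝ) :
    ℓ (Fin.snoc y s : Fin (n + 1) → ℝ) =
      ℓ.comp (snocZeroL n).toAffineMap y + s * ℓ.linear (lastVec n) := by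
  have : (Fin.snoc y s : Fin (n + 1) → ℝ) = (s • lastVec n) +ᵥ snocZeroL n y :=
    (snocZeroL_add y s).symm.trans (add_comm _ _)
  rw [this, AffineMap.map_vadd, map_smul]
  simp [add_comm]

theorem eq_smul_lastVec {n : ℕ} {u : Fin (n + 1) → ℝ} (hu : initL n u = 0) :
    u = u (Fin.last n) • lastVec n := by
  rw [initL_apply] at hu
  conv_lhs => rw [← Fin.snoc_init_self u, hu, ← snocZeroL_add]
  simp

theorem initL_lastVec (n : ℕ) : initL n (lastVec n) = 0 := by
  ext i; simp [initL_apply, Fin.init, lastVec]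

/-- A continuous function which is at every point the minimum (or, for `ε < 0`, the maximum) of
finitely many affine functions is definable. -/
theorem isDefinableContinuousOn_of_piecewise (O : OMinimalStructure) {n : ℕ} {ι : Type} [Finite ι]
    (b : ι → (Fin n → ℝ) →ᵃ[ℝ] ℝ) {ε : ℝ} (hε : ε ≠ 0) {φ : (Fin n → ℝ) → ℝ}
    (hφ : Continuous φ) (h1 : ∀ y, ∃ i, φ y = b i y) (h2 : ∀ y i, ε * φ y ≤ ε * b i y)
    {B : Set (Fin n → ℝ)} (hB : B ∈ O.Def n) : IsDefinableContinuousOn O φ B := by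
  refine ⟨?_, hφ.continuousOn⟩
  let c : ι → (Fin (n + 1) → ℝ) →ᵃ[ℝ] ℝ := fun i =>
    (b i).comp (initL n).toAffineMap - (lastL n).toAffineMap
  have hc : ∀ i z, c i z = b i (Fin.init z) - z (Fin.last n) := fun i z => rfl
  -- A height is the extremum of the `b i` exactly when it is on the correct side of all of them and
  -- equal to one of them.
  convert O.inter_mem (O.prod_right hB) (O.inter_mem
    (O.iInter_mem fun i => O.affine_nonneg_mem (ε • c i))
    (O.iUnion_mem fun i => O.affine_eq_zero_mem (c i))) using 1
  ext z
  simp only [mem_ofPred_eq, mem_inter_iff, mem_iInter, mem_iUnion, AffineMap.coe_smul,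
    Pi.smul_apply, hc, smul_eq_mul, mul_sub, sub_nonneg, sub_eq_zero]
  refine and_congr_right fun _ => ⟨fun h => ?_, fun ⟨h, i, hi⟩ => ?_⟩
  · rw [h]
    exact ⟨fun i => h2 _ i, (h1 _).imp fun i hi => hi.symm⟩
  · obtain ⟨k, hk⟩ := h1 (Fin.init z)
    have h3 := h2 (Fin.init z) i
    have h4 := h k
    rw [hi] at h3
    rw [← hk] at h4
    exact mul_left_cancel₀ hε (le_antisymm h4 h3)

/-- Lower boundary of a band. For an empty family the supremum in `EReal` is `⊥`, which is the bound
required when no inequality limits the height from below. -/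
theorem isBandBound_sup (O : OMinimalStructure) {n : ℕ} {ι : Type} [Fintype ι]
    (b : ι → (Fin n → ℝ) →ᵃ[ℝ] ℝ) {B : Set (Fin n → ℝ)} (hB : B ∈ O.Def n) :
    IsBandBound O (fun y => Finset.univ.sup fun i => (b i y : EReal)) B := by
  rcases isEmpty_or_nonempty ι with hι | hι
  · exact Or.inl fun y _ => by simp
  · refine Or.inr (Or.inr ⟨fun y => Finset.univ.sup' Finset.univ_nonempty fun i => b i y, ?_, ?_⟩)
    · refine isDefinableContinuousOn_of_piecewise O b (ε := -1) (by norm_num) ?_ (fun y => ?_)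
        (fun y i => ?_) hB
      · exact Continuous.finset_sup'_apply _ fun i _ => (b i).continuous_of_finiteDimensional
      · obtain ⟨i, _, hi⟩ := Finset.exists_mem_eq_sup' Finset.univ_nonempty fun i => b i y
        exact ⟨i, hi⟩
      · have := Finset.le_sup' (fun i => b i y) (Finset.mem_univ i)
        linarith
    · intro y _
      beta_reduce
      rw [← Finset.sup'_eq_sup Finset.univ_nonempty]
      exact (Finset.apply_sup'_eq_sup'_comp Finset.univ_nonempty Real.toEReal
        fun x y => EReal.coe_strictMono.monotone.map_sup x y).symm

theorem isBandBound_inf (O : OMinimalStructure) {n : ℕ} {ι : Type} [Fintype ι]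
    (b : ι → (Fin n → ℝ) →ᵃ[ℝ] ℝ) {B : Set (Fin n → ℝ)} (hB : B ∈ O.Def n) :
    IsBandBound O (fun y => Finset.univ.inf fun i => (b i y : EReal)) B := by
  rcases isEmpty_or_nonempty ι with hι | hι
  · exact Or.inr (Or.inl fun y _ => by simp)
  · refine Or.inr (Or.inr ⟨fun y => Finset.univ.inf' Finset.univ_nonempty fun i => b i y, ?_, ?_⟩)
    · refine isDefinableContinuousOn_of_piecewise O b (ε := 1) (by norm_num) ?_ (fun y => ?_)
        (fun y i => ?_) hB
      · exact Continuous.finset_inf'_apply _ fun i _ => (b i).continuous_of_finiteDimensional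
      · obtain ⟨i, _, hi⟩ := Finset.exists_mem_eq_inf' Finset.univ_nonempty fun i => b i y
        exact ⟨i, hi⟩
      · have := Finset.inf'_le (fun i => b i y) (Finset.mem_univ i)
        linarith
    · intro y _
      beta_reduce
      rw [← Finset.inf'_eq_inf Finset.univ_nonempty]
      exact (Finset.apply_inf'_eq_inf'_comp Finset.univ_nonempty Real.toEReal
        fun x y => EReal.coe_strictMono.monotone.map_inf x y).symm

/-- An affine subspace without vertical direction is the graph of an affine function. -/
theorem exists_affine_graph {n : ℕ} {A : AffineSubspace ℝ (Fin (n + 1) → ℝ)}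
    (hA : lastVec n ∉ A.direction) {z₀ : Fin (n + 1) → ℝ} (hz₀ : z₀ ∈ A) :
    (∃ φ : (Fin n → ℝ) →ᵃ[ℝ] ℝ, ∀ z, z ∈ A ↔
        Fin.init z ∈ A.map (initL n).toAffineMap ∧ z (Fin.last n) = φ (Fin.init z)) ∧
      finrank ℝ (A.map (initL n).toAffineMap).direction = finrank ℝ A.direction := by
  set π := (initL n).domRestrict A.direction with hπ
  have hker : LinearMap.ker π = ⊥ := by
    refine (Submodule.eq_bot_iff _).2 fun u hu => ?_
    have h1 := eq_smul_lastVec (u := (u : Fin (n + 1) → ℝ)) hu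
    by_contra hne
    have h0 : (u : Fin (n + 1) → ℝ) (Fin.last n) ≠ 0 := fun h0 => hne (by
      ext1; rw [h1, h0, zero_smul]; rfl)
    refine hA ?_
    have := A.direction.smul_mem ((u : Fin (n + 1) → ℝ) (Fin.last n))⁻¹ u.2
    rwa [h1, smul_smul, Pi.smul_apply, smul_eq_mul, show lastVec n (Fin.last n) = 1 by
      simp [lastVec], mul_one, inv_mul_cancel₀ h0, one_smul] at this
  obtain ⟨g, hg⟩ := π.exists_leftInverse_of_injective hker
  -- The projection is injective on the direction of `A`, so `g` recovers a direction vector from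
  -- its projection; `φ` reads off its last coordinate, and the constant adjusts the value at `z₀`.
  let φ : (Fin n → ℝ) →ᵃ[ℝ] ℝ := ((lastL n).comp (A.direction.subtype.comp g)).toAffineMap +
    AffineMap.const ℝ _ (z₀ (Fin.last n) - (g (Fin.init z₀) : Fin (n + 1) → ℝ) (Fin.last n))
  have hφ : ∀ z ∈ A, z (Fin.last n) = φ (Fin.init z) := fun z hz => by
    have hd : z - z₀ ∈ A.direction := A.vsub_mem_direction hz hz₀
    have := congrArg (fun u : A.direction => (u : Fin (n + 1) → ℝ) (Fin.last n))
      (LinearMap.congr_fun hg ⟨z - z₀, hd⟩)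
    have h2 : π ⟨z - z₀, hd⟩ = Fin.init z - Fin.init z₀ := rfl
    simp only [LinearMap.comp_apply, h2, map_sub, LinearMap.id_apply, Submodule.coe_sub,
      Pi.sub_apply] at this
    change _ = (g (Fin.init z) : Fin (n + 1) → ℝ) (Fin.last n) +
      (z₀ (Fin.last n) - (g (Fin.init z₀) : Fin (n + 1) → ℝ) (Fin.last n))
    linarith
  refine ⟨⟨φ, fun z => ⟨fun hz => ⟨⟨z, hz, rfl⟩, hφ z hz⟩, fun ⟨⟨z', hz', h1⟩, h2⟩ => ?_⟩⟩, ?_⟩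
  · have h1 : Fin.init z' = Fin.init z := h1
    have h3 := hφ z' hz'
    rw [h1, ← h2] at h3
    rwa [← Fin.snoc_init_self z, ← h1, ← h3, Fin.snoc_init_self]
  · rw [AffineSubspace.map_direction, ← LinearMap.finrank_range_of_inj (LinearMap.ker_eq_bot.1 hker),
      hπ, LinearMap.range_domRestrict]
    rfl

/-- An affine subspace with the vertical direction is a cylinder. -/
theorem cylinder_of_lastVec_mem {n : ℕ} {A : AffineSubspace ℝ (Fin (n + 1) → ℝ)}
    (hA : lastVec n ∈ A.direction) :
    (∀ z, z ∈ A ↔ Fin.init z ∈ A.map (initL n).toAffineMap) ∧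
      finrank ℝ A.direction = finrank ℝ (A.map (initL n).toAffineMap).direction + 1 := by
  refine ⟨fun z => ⟨fun hz => ⟨z, hz, rfl⟩, fun ⟨z', hz', h⟩ => ?_⟩, ?_⟩
  · have h0 : initL n (z - z') = 0 := by
      rw [map_sub, sub_eq_zero]; exact h.symm
    have := A.vadd_mem_of_mem_direction (A.direction.smul_mem ((z - z') (Fin.last n)) hA) hz'
    rw [← eq_smul_lastVec h0] at this
    simpa using this
  -- Rank-nullity: the kernel of the projection on the direction of `A` is the vertical line.
  · have h1 := LinearMap.finrank_range_add_finrank_ker ((initL n).domRestrict A.direction)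
    rw [LinearMap.range_domRestrict] at h1
    rw [AffineSubspace.map_direction, ← h1]
    congr 1
    refine finrank_eq_one (⟨⟨lastVec n, hA⟩, initL_lastVec n⟩ :
      LinearMap.ker ((initL n).domRestrict A.direction)) ?_ fun u => ?_
    · intro h
      have := congrFun (congrArg (fun u : LinearMap.ker ((initL n).domRestrict A.direction) =>
        ((u : A.direction) : Fin (n + 1) → ℝ)) h) (Fin.last n)
      simp [lastVec] at this
    · refine ⟨((u : A.direction) : Fin (n + 1) → ℝ) (Fin.last n), ?_⟩
      ext1; ext1
      exact (eq_smul_lastVec u.2).symm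

/-- Fourier–Motzkin elimination, by induction on `n`. The projection of the polyhedron is again a
nonempty relatively open polyhedron. Above it lies a band if `A` contains the vertical direction,
which adds one dimension, and the graph of an affine function otherwise. -/
theorem openPolyhedron.isCell (O : OMinimalStructure) : ∀ {n : ℕ} {ι : Type} [Finite ι]
    (A : AffineSubspace ℝ (Fin n → ℝ)) (ℓ : ι → (Fin n → ℝ) →ᵃ[ℝ] ℝ),
    (openPolyhedron A ℓ).Nonempty →
      IsCell O n (finrank ℝ A.direction) (openPolyhedron A ℓ) := by
  classical
  intro n
  induction n with
  | zero =>
    intro ι _ A ℓ hne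
    have h1 : openPolyhedron A ℓ = univ := hne.eq_univ
    rw [h1, finrank_zero_of_subsingleton]
    exact IsCell.point
  | succ n ih =>
    intro ι _ A ℓ hne
    have hdef := openPolyhedron.mem_def O A ℓ
    have := Fintype.ofFinite ι
    obtain ⟨z₀, hz₀⟩ := hne
    by_cases hA : lastVec n ∈ A.direction
    · obtain ⟨hcyl, hrank⟩ := cylinder_of_lastVec_mem hA
      let c : ι → ℝ := fun i => (ℓ i).linear (lastVec n)
      let a : ι → (Fin n → ℝ) →ᵃ[ℝ] ℝ := fun i => (ℓ i).comp (snocZeroL n).toAffineMap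
      have hℓ : ∀ i z, ℓ i z = a i (Fin.init z) + z (Fin.last n) * c i := fun i z => by
        conv_lhs => rw [← Fin.snoc_init_self z]
        exact apply_snoc _ _ _
      let b : ι → (Fin n → ℝ) →ᵃ[ℝ] ℝ := fun i => (-(c i)⁻¹) • a i
      have hb : ∀ i y, b i y = -(c i)⁻¹ * a i y := fun i y => rfl
      have hpos : ∀ i, 0 < c i → ∀ z, (0 < ℓ i z ↔ b i (Fin.init z) < z (Fin.last n)) := by
        intro i hi z
        have : b i (Fin.init z) = -(a i (Fin.init z)) / c i := by rw [hb]; ring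
        rw [hℓ, this, div_lt_iff₀ hi]
        constructor <;> intro <;> linarith
      have hneg : ∀ i, c i < 0 → ∀ z, (0 < ℓ i z ↔ z (Fin.last n) < b i (Fin.init z)) := by
        intro i hi z
        have : b i (Fin.init z) = -(a i (Fin.init z)) / c i := by rw [hb]; ring
        rw [hℓ, this, lt_div_iff_of_neg hi]
        constructor <;> intro <;> linarith
      let f : (Fin n → ℝ) → EReal := fun y =>
        Finset.univ.sup fun i : {i // 0 < c i} => (b i y : EReal)
      let g : (Fin n → ℝ) → EReal := fun y =>
        Finset.univ.inf fun i : {i // c i < 0} => (b i y : EReal)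
      -- Inequalities of the projection: those that do not involve the height, and one for each pair
      -- of a lower and an upper bound, saying that the lower is strictly below the upper.
      let ℓ' : {i // c i = 0} ⊕ {i // 0 < c i} × {i // c i < 0} → (Fin n → ℝ) →ᵃ[ℝ] ℝ :=
        Sum.elim (fun i => a i) fun p => b p.2 - b p.1
      let B := openPolyhedron (A.map (initL n).toAffineMap) ℓ'
      have hB : ∀ y, y ∈ B ↔ y ∈ A.map (initL n).toAffineMap ∧ (∀ i, c i = 0 → 0 < a i y) ∧
          f y < g y := fun y => by
        have hfg : f y < g y ↔ ∀ p : {i // 0 < c i} × {i // c i < 0}, b p.1 y < b p.2 y := by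
          refine ⟨fun h p => ?_, fun h => ?_⟩
          · have h1 : (b p.1 y : EReal) ≤ f y :=
              Finset.le_sup (f := fun i : {i // 0 < c i} => (b i y : EReal)) (Finset.mem_univ p.1)
            have h2 : g y ≤ (b p.2 y : EReal) :=
              Finset.inf_le (f := fun i : {i // c i < 0} => (b i y : EReal)) (Finset.mem_univ p.2)
            exact EReal.coe_lt_coe_iff.1 (h1.trans_lt (h.trans_le h2))
          · refine (Finset.sup_lt_iff ?_).2 fun i _ => (Finset.lt_inf_iff ?_).2 fun j _ =>
              EReal.coe_lt_coe_iff.2 (h (i, j))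
            -- These two side conditions cover the cases where there is no lower or no upper bound.
            · exact (Finset.lt_inf_iff bot_lt_top).2 fun j _ => EReal.bot_lt_coe _
            · exact EReal.coe_lt_top _
        rw [hfg]
        change (_ ∧ ∀ i, 0 < ℓ' i y) ↔ _
        rw [Sum.forall]
        simp only [ℓ', Sum.elim_inl, Sum.elim_inr, Subtype.forall]
        refine and_congr_right fun _ => and_congr_right fun _ => forall_congr' fun p => ?_
        exact sub_pos
      have hC : openPolyhedron A ℓ = {z : Fin (n + 1) → ℝ | Fin.init z ∈ B ∧ f (Fin.init z) < (z (Fin.last n) : EReal)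
          ∧ (z (Fin.last n) : EReal) < g (Fin.init z)} := by
        ext z
        have hf : f (Fin.init z) < (z (Fin.last n) : EReal) ↔ ∀ i, 0 < c i → 0 < ℓ i z := by
          rw [Finset.sup_lt_iff (EReal.bot_lt_coe _)]
          simp only [Finset.mem_univ, true_implies, Subtype.forall, EReal.coe_lt_coe_iff]
          exact forall₂_congr fun i hi => (hpos i hi z).symm
        have hg : (z (Fin.last n) : EReal) < g (Fin.init z) ↔ ∀ i, c i < 0 → 0 < ℓ i z := by
          rw [Finset.lt_inf_iff (EReal.coe_lt_top _)]
          simp only [Finset.mem_univ, true_implies, Subtype.forall, EReal.coe_lt_coe_iff]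
          exact forall₂_congr fun i hi => (hneg i hi z).symm
        have h0 : ∀ i, c i = 0 → a i (Fin.init z) = ℓ i z := fun i hi => by rw [hℓ, hi]; ring
        rw [mem_ofPred_eq, hB, ← hcyl]
        constructor
        · rintro ⟨h1, h2⟩
          exact ⟨⟨h1, fun i hi => by rw [h0 i hi]; exact h2 i,
            (hf.2 fun i _ => h2 i).trans (hg.2 fun i _ => h2 i)⟩, hf.2 fun i _ => h2 i,
            hg.2 fun i _ => h2 i⟩
        · rintro ⟨⟨h1, h2, _⟩, h3, h4⟩
          refine ⟨h1, fun i => ?_⟩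
          rcases lt_trichotomy (c i) 0 with hi | hi | hi
          · exact hg.1 h4 i hi
          · rw [← h0 i hi]; exact h2 i hi
          · exact hf.1 h3 i hi
      have hBimg : B = Fin.init '' openPolyhedron A ℓ := by
        ext y
        constructor
        · intro hy
          obtain ⟨s, hs1, hs2⟩ := EReal.lt_iff_exists_real_btwn.1 ((hB y).1 hy).2.2
          refine ⟨Fin.snoc y s, ?_, Fin.init_snoc _ _⟩
          rw [hC]
          simpa using ⟨hy, hs1, hs2⟩
        · rintro ⟨z, hz, rfl⟩
          rw [hC] at hz
          exact hz.1
      have hBdef : B ∈ O.Def n := hBimg ▸ O.image_init_mem hdef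
      have hBne : B.Nonempty := hBimg ▸ ⟨_, mem_image_of_mem _ hz₀⟩
      rw [hrank, hC]
      exact IsCell.band f g (ih _ ℓ' hBne) (isBandBound_sup O _ hBdef)
        (isBandBound_inf O _ hBdef) fun y hy => ((hB y).1 hy).2.2
    · obtain ⟨⟨φ, hφ⟩, hrank⟩ := exists_affine_graph hA hz₀.1
      -- The affine section of the projection whose image over the projected subspace is `A`; the
      -- inequalities are pulled back along it.
      let s : (Fin n → ℝ) →ᵃ[ℝ] (Fin (n + 1) → ℝ) := (snocZeroL n).toAffineMap +
        (LinearMap.toSpanSingleton ℝ _ (lastVec n)).toAffineMap.comp φ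
      have hs : ∀ y, s y = Fin.snoc y (φ y) := fun y => snocZeroL_add y (φ y)
      let B := openPolyhedron (A.map (initL n).toAffineMap) fun i => (ℓ i).comp s
      have hC : openPolyhedron A ℓ = {z : Fin (n + 1) → ℝ | Fin.init z ∈ B ∧
          z (Fin.last n) = φ (Fin.init z)} := by
        ext z
        change (z ∈ A ∧ ∀ i, 0 < ℓ i z) ↔ (_ ∧ ∀ i, 0 < ℓ i (s (Fin.init z))) ∧ _
        rw [hφ, and_right_comm]
        refine and_congr_left fun h => and_congr_right fun _ => ?_
        rw [hs, ← h, Fin.snoc_init_self]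
      have hBimg : B = Fin.init '' openPolyhedron A ℓ := by
        ext y
        constructor
        · intro hy
          refine ⟨Fin.snoc y (φ y), ?_, Fin.init_snoc _ _⟩
          rw [hC]
          simpa using hy
        · rintro ⟨z, hz, rfl⟩
          rw [hC] at hz
          exact hz.1
      have hBdef : B ∈ O.Def n := hBimg ▸ O.image_init_mem hdef
      have hBne : B.Nonempty := hBimg ▸ ⟨_, mem_image_of_mem _ hz₀⟩
      have hcell := ih _ _ hBne
      rw [hrank] at hcell
      rw [hC] at hdef ⊢
      exact IsCell.graph φ hcell ⟨hdef, φ.continuous_of_finiteDimensional.continuousOn⟩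

/-! ### Additivity of the Euler characteristic -/

theorem HasEulerChar.of_fintype {O : OMinimalStructure} {n : ℕ} {κ : Type*} [Fintype κ]
    {C : κ → Set (Fin n → ℝ)} {k : κ → ℕ} (hC : ∀ i, IsCell O n (k i) (C i))
    (hd : ∀ i j, i ≠ j → Disjoint (C i) (C j)) :
    HasEulerChar O (⋃ i, C i) (∑ i, (-1) ^ k i) := by
  let e := (Fintype.equivFin κ).symm
  exact ⟨Fintype.card κ, C ∘ e, k ∘ e, fun i => hC _, fun i j hij => hd _ _ (e.injective.ne hij),
    e.surjective.iUnion_comp C, (e.sum_comp fun i => (-1 : ℤ) ^ k i).symm⟩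

theorem HasEulerChar.iUnion {O : OMinimalStructure} {n : ℕ} {ι : Type*} [Fintype ι]
    {X : ι → Set (Fin n → ℝ)} {e : ι → ℤ} (h : ∀ i, HasEulerChar O (X i) (e i))
    (hd : ∀ i j, i ≠ j → Disjoint (X i) (X j)) : HasEulerChar O (⋃ i, X i) (∑ i, e i) := by
  choose m C k hC hdC hX he using h
  have hsub : ∀ i a, C i a ⊆ X i := fun i a => hX i ▸ subset_iUnion (C i) a
  have := HasEulerChar.of_fintype (O := O) (κ := Σ i, Fin (m i)) (C := fun p => C p.1 p.2)
    (k := fun p => k p.1 p.2) (fun p => hC _ _) (by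
      rintro ⟨i, a⟩ ⟨j, b⟩ hij
      by_cases h : i = j
      · subst h
        exact hdC i a b fun hab => hij (by rw [hab])
      · exact (hd i j h).mono (hsub i a) (hsub j b))
  rw [Fintype.sum_sigma, iUnion_sigma] at this
  simpa only [he, hX] using this

theorem HasEulerChar.empty (O : OMinimalStructure) (n : ℕ) :
    HasEulerChar O (∅ : Set (Fin n → ℝ)) 0 := by
  simpa using HasEulerChar.iUnion (O := O) (ι := Empty) (X := fun _ => (∅ : Set (Fin n → ℝ)))
    (e := fun _ => 0) (fun i => i.elim) (fun i => i.elim)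

theorem HasEulerChar.union {O : OMinimalStructure} {n : ℕ} {X Y : Set (Fin n → ℝ)} {a b : ℤ}
    (hX : HasEulerChar O X a) (hY : HasEulerChar O Y b) (hd : Disjoint X Y) :
    HasEulerChar O (X ∪ Y) (a + b) := by
  have := HasEulerChar.iUnion (O := O) (ι := Bool) (X := fun i => cond i X Y)
    (e := fun i => cond i a b) (by simp [hX, hY]) (by simp [hd, hd.symm])
  simpa [union_eq_iUnion] using this

theorem IsCell.hasEulerChar {O : OMinimalStructure} {n k : ℕ} {C : Set (Fin n → ℝ)}
    (h : IsCell O n k C) : HasEulerChar O C ((-1) ^ k) := by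
  simpa [iUnion_const] using HasEulerChar.of_fintype (O := O) (κ := Unit) (C := fun _ => C)
    (k := fun _ => k) (fun _ => h) (by simp)

/-! ### Cutting a relatively open polyhedron by a half-space -/

/-- A relatively open polyhedron which crosses the hyperplane `f = 0` meets the closed half-space
`f ≤ 0` in a set of Euler characteristic zero. -/
theorem openPolyhedron.hasEulerChar_cut (O : OMinimalStructure) {n : ℕ} {ι : Type} [Finite ι]
    (A : AffineSubspace ℝ (Fin n → ℝ)) (ℓ : ι → (Fin n → ℝ) →ᵃ[ℝ] ℝ)
    (f : (Fin n → ℝ) →ᵃ[ℝ] ℝ) {x₁ x₂ : Fin n → ℝ} (h₁ : x₁ ∈ openPolyhedron A ℓ)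
    (h₂ : x₂ ∈ openPolyhedron A ℓ) (hf₁ : f x₁ < 0) (hf₂ : 0 < f x₂) :
    HasEulerChar O {x | x ∈ openPolyhedron A ℓ ∧ f x ≤ 0} 0 := by
  obtain ⟨x₀, h₀, hf₀⟩ : ∃ x₀ ∈ openPolyhedron A ℓ, f x₀ = 0 := by
    -- The parameter at which `f` vanishes on the segment from `x₁` to `x₂`.
    let t := -f x₁ / (f x₂ - f x₁)
    have hpos : 0 < f x₂ - f x₁ := by linarith
    have ht0 : 0 ≤ t := div_nonneg (by linarith) hpos.le
    have ht1 : t ≤ 1 := (div_le_one hpos).2 (by linarith)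
    refine ⟨AffineMap.lineMap x₁ x₂ t, ⟨AffineMap.lineMap_mem t h₁.1 h₂.1, fun i => ?_⟩, ?_⟩
    · rw [AffineMap.apply_lineMap, AffineMap.lineMap_apply_module]
      have := (convex_Ioi (0 : ℝ)) (h₁.2 i) (h₂.2 i) (by linarith : 0 ≤ 1 - t) ht0 (by ring)
      exact this
    · rw [AffineMap.apply_lineMap, AffineMap.lineMap_apply_ring']
      simp only [t]
      field_simp
      ring
  -- The part `f < 0`: one more strict inequality in the same affine subspace, so the dimension is
  -- unchanged.
  have hlt := openPolyhedron.isCell O A (fun i : Option ι => i.elim (-f) ℓ)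
    ⟨x₁, h₁.1, by rintro (_ | i); exacts [by simpa using hf₁, h₁.2 i]⟩
  let A₀ := AffineSubspace.mk' x₀ (A.direction ⊓ LinearMap.ker f.linear)
  have hA₀ : ∀ x, x ∈ A₀ ↔ x ∈ A ∧ f x = 0 := fun x => by
    rw [AffineSubspace.mem_mk', Submodule.mem_inf,
      AffineSubspace.vsub_right_mem_direction_iff_mem h₀.1, LinearMap.mem_ker,
      AffineMap.linearMap_vsub, hf₀, vsub_eq_sub, sub_zero]
  have heq := openPolyhedron.isCell O A₀ ℓ ⟨x₀, (hA₀ _).2 ⟨h₀.1, hf₀⟩, h₀.2⟩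
  -- `f` takes different values at `x₁` and `x₂`, so its linear part is nonzero on the direction of
  -- `A`, and its kernel there has codimension one.
  have hrank : finrank ℝ A.direction = finrank ℝ A₀.direction + 1 := by
    have hne : f.linear.domRestrict A.direction ≠ 0 := fun h => by
      have := LinearMap.congr_fun h ⟨x₂ -ᵥ x₁, A.vsub_mem_direction h₂.1 h₁.1⟩
      rw [LinearMap.domRestrict_apply, AffineMap.linearMap_vsub, vsub_eq_sub] at this
      simp only [LinearMap.zero_apply] at this
      linarith
    rw [← Module.Dual.finrank_ker_add_one_of_ne_zero hne, AffineSubspace.direction_mk',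
      ← Submodule.finrank_map_subtype_eq, LinearMap.ker_domRestrict,
      Submodule.map_comap_subtype]
  convert hlt.hasEulerChar.union heq.hasEulerChar ?_ using 1
  · ext x
    simp only [openPolyhedron, mem_union, mem_ofPred_eq, hA₀, Option.forall]
    simp only [Option.elim_none, Option.elim_some, AffineMap.coe_neg, Pi.neg_apply, neg_pos,
      le_iff_lt_or_eq]
    tauto
  · rw [hrank]; ring
  · refine disjoint_left.2 fun x hx hx' => ?_
    have h1 : 0 < (-f) x := hx.2 none
    have h2 := ((hA₀ x).1 hx'.1).2
    simp [h2] at h1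

/-! ### Open simplices -/

section OpenSimplex

variable {d : ℕ}

local notation "E" => EuclideanSpace ℝ (Fin d)

theorem affine_sum {V : Type*} [AddCommGroup V] [Module ℝ V] (f : V →ᵃ[ℝ] ℝ) (σ : Finset V)
    {w : V → ℝ} (hw : ∑ p ∈ σ, w p = 1) : f (∑ p ∈ σ, w p • p) = ∑ p ∈ σ, w p * f p := by
  have h : ∀ x, f x = f.linear x + f 0 := congrFun (AffineMap.decomp f)
  rw [h, map_sum, ← one_mul (f 0), ← hw, Finset.sum_mul, ← Finset.sum_add_distrib]
  exact Finset.sum_congr rfl fun p _ => by rw [map_smul, smul_eq_mul, ← mul_add, ← h]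

/-- Extending the vertices to an affine basis of `V` makes the barycentric coordinates affine
functions on the whole space, so that they can serve as inequalities of a polyhedron. -/
theorem exists_barycentric {V : Type*} [AddCommGroup V] [Module ℝ V] {σ : Finset V}
    (hσ : AffineIndependent ℝ ((↑) : σ → V)) :
    ∃ c : V → V →ᵃ[ℝ] ℝ, ∀ p ∈ σ, ∀ w : V → ℝ, ∑ q ∈ σ, w q = 1 →
      c p (∑ q ∈ σ, w q • q) = w p := by
  classical
  obtain ⟨t, hst, ht, htop⟩ := exists_subset_affineIndependent_affineSpan_eq_top (s := (σ : Set V)) hσ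
  let b : AffineBasis t ℝ V := ⟨(↑), ht, by simpa using htop⟩
  refine ⟨fun p => if h : p ∈ t then b.coord ⟨p, h⟩ else 0, fun p hp w hw => ?_⟩
  beta_reduce
  rw [affine_sum _ _ hw, dif_pos (hst hp), Finset.sum_eq_single_of_mem p hp]
  · have := b.coord_apply ⟨p, hst hp⟩ ⟨p, hst hp⟩
    rw [if_pos rfl] at this
    change w p * b.coord ⟨p, hst hp⟩ (b ⟨p, hst hp⟩) = w p
    rw [this, mul_one]
  · intro q hq hqp
    have := b.coord_apply ⟨p, hst hp⟩ ⟨q, hst hq⟩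
    rw [if_neg fun h => hqp (Subtype.ext_iff.1 h).symm] at this
    change w q * b.coord ⟨p, hst hp⟩ (b ⟨q, hst hq⟩) = 0
    rw [this, mul_zero]

theorem mem_affineSpan_finset_iff {V : Type*} [AddCommGroup V] [Module ℝ V] {σ : Finset V} {x : V} :
    x ∈ affineSpan ℝ (σ : Set V) ↔ ∃ w : V → ℝ, ∑ p ∈ σ, w p = 1 ∧ ∑ p ∈ σ, w p • p = x := by
  classical
  have hr : (σ : Set V) = range ((↑) : σ → V) := by simp
  constructor
  · intro hx
    rw [hr] at hx
    obtain ⟨w, hw, rfl⟩ := eq_affineCombination_of_mem_affineSpan_of_fintype hx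
    rw [Finset.affineCombination_eq_linear_combination _ _ _ hw]
    refine ⟨fun p => if h : p ∈ σ then w ⟨p, h⟩ else 0, ?_, ?_⟩
    · rw [← Finset.sum_coe_sort σ, ← hw]
      exact Finset.sum_congr rfl fun p _ => by simp
    · rw [← Finset.sum_coe_sort σ]
      exact Finset.sum_congr rfl fun p _ => by simp
  · rintro ⟨w, hw, rfl⟩
    rw [← Finset.sum_coe_sort σ] at hw
    rw [← Finset.sum_coe_sort σ, hr, ← Finset.affineCombination_eq_linear_combination
      Finset.univ ((↑) : σ → V) (fun p => w p) hw]
    exact affineCombination_mem_affineSpan hw _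

/-- Inside the affine span of σ, the open simplex is where all barycentric coordinates are positive.
Everything is transported to `Fin d → ℝ`, where cells live. -/
theorem openSimplex_eq_openPolyhedron {σ : Finset E} (hne : σ.Nonempty)
    (hσ : AffineIndependent ℝ ((↑) : σ → E)) :
    ∃ (A : AffineSubspace ℝ (Fin d → ℝ)) (ℓ : σ → (Fin d → ℝ) →ᵃ[ℝ] ℝ),
      {y : Fin d → ℝ | WithLp.toLp 2 y ∈ openSimplex σ} = openPolyhedron A ℓ ∧
        finrank ℝ A.direction = σ.card - 1 := by
  obtain ⟨c, hc⟩ := exists_barycentric hσ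
  let e : E ≃ₗ[ℝ] (Fin d → ℝ) := WithLp.linearEquiv 2 ℝ (Fin d → ℝ)
  let A := (affineSpan ℝ (σ : Set E)).map (e : E →ₗ[ℝ] (Fin d → ℝ)).toAffineMap
  have hA : ∀ y : Fin d → ℝ, y ∈ A ↔ WithLp.toLp 2 y ∈ affineSpan ℝ (σ : Set E) := fun y => by
    constructor
    · rintro ⟨x, hx, rfl⟩; exact hx
    · intro hx; exact ⟨_, hx, rfl⟩
  refine ⟨A, fun p => (c p).comp (e.symm : (Fin d → ℝ) →ₗ[ℝ] E).toAffineMap, ?_, ?_⟩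
  · ext y
    change _ ↔ y ∈ A ∧ ∀ p : σ, 0 < c p (WithLp.toLp 2 y)
    rw [hA, mem_affineSpan_finset_iff]
    constructor
    · rintro ⟨w, hpos, hw, hy⟩
      refine ⟨⟨w, hw, hy⟩, fun p => ?_⟩
      rw [← hy, hc p p.2 w hw]
      exact hpos p p.2
    · rintro ⟨⟨w, hw, hy⟩, hpos⟩
      refine ⟨w, fun p hp => ?_, hw, hy⟩
      have := hpos ⟨p, hp⟩
      rwa [← hy, hc p hp w hw] at this
  · rw [AffineSubspace.map_direction]
    refine (LinearEquiv.finrank_map_eq e _).trans ?_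
    rw [direction_affineSpan]
    have := hσ.finrank_vectorSpan (n := σ.card - 1) (by
      rw [Fintype.card_coe]; have := hne.card_pos; omega)
    rwa [show range ((↑) : σ → E) = (σ : Set E) by simp] at this

theorem openSimplex_nonempty {σ : Finset E} (hne : σ.Nonempty) : (openSimplex σ).Nonempty := by
  have : (0 : ℝ) < σ.card := by exact_mod_cast hne.card_pos
  exact ⟨_, fun _ => (σ.card : ℝ)⁻¹, fun _ _ => by positivity, by simp [this.ne'], rfl⟩

theorem apply_nonpos_of_mem_openSimplex {σ : Finset E} {f : E →ᵃ[ℝ] ℝ} (hf : ∀ p ∈ σ, f p ≤ 0)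
    {x : E} (hx : x ∈ openSimplex σ) : f x ≤ 0 := by
  obtain ⟨w, hpos, hw, rfl⟩ := hx
  rw [affine_sum f σ hw]
  exact Finset.sum_nonpos fun p hp => mul_nonpos_of_nonneg_of_nonpos (hpos p hp).le (hf p hp)

/-- A point of an open simplex may be moved slightly away from a vertex, and by any amount less
than one towards it. -/
theorem exists_lineMap_mem_openSimplex {σ : Finset E} {x p : E} (hx : x ∈ openSimplex σ)
    (hp : p ∈ σ) : ∃ ε > (0 : ℝ), ∀ s, -ε ≤ s → s < 1 → AffineMap.lineMap x p s ∈ openSimplex σ := by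
  classical
  obtain ⟨w, hpos, hw, rfl⟩ := hx
  -- The weight of `p` becomes `(1 - s) * w p + s`, which stays positive for `s ≥ -w p / 2` because
  -- `w p ≤ 1`; the other weights are scaled by `1 - s > 0`.
  refine ⟨w p / 2, half_pos (hpos p hp), fun s hs hs1 =>
    ⟨fun q => (1 - s) * w q + if q = p then s else 0, fun q hq => ?_, ?_, ?_⟩⟩
  · have h1 : 0 < (1 - s) * w q := mul_pos (by linarith) (hpos q hq)
    dsimp only
    split_ifs with h
    · subst h
      have h2 : w q ≤ 1 := hw ▸ Finset.single_le_sum (fun i hi => (hpos i hi).le) hq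
      rcases le_or_gt 0 s with h0 | h0
      · linarith
      · nlinarith [hpos q hq]
    · linarith
  · simp [Finset.sum_add_distrib, ← Finset.mul_sum, hw, hp]
  · simp [add_smul, Finset.sum_add_distrib, mul_smul, ← Finset.smul_sum, hp, ite_smul,
      AffineMap.lineMap_apply_module]

/-- The Euler characteristic of the part of an open simplex in a closed half-space. -/
theorem hasEulerChar_openSimplex_cut (O : OMinimalStructure) {σ : Finset E} (hne : σ.Nonempty)
    (hσ : AffineIndependent ℝ ((↑) : σ → E)) (f : E →ᵃ[ℝ] ℝ) [Decidable (∀ p ∈ σ, f p ≤ 0)] :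
    HasEulerChar O {y : Fin d → ℝ | WithLp.toLp 2 y ∈ openSimplex σ ∧ f (WithLp.toLp 2 y) ≤ 0}
      (if ∀ p ∈ σ, f p ≤ 0 then (-1) ^ (σ.card - 1) else 0) := by
  obtain ⟨A, ℓ, hAℓ, hrank⟩ := openSimplex_eq_openPolyhedron hne hσ
  have hmem : ∀ x : E, x ∈ openSimplex σ → WithLp.ofLp x ∈ openPolyhedron A ℓ := fun x hx => by
    rw [← hAℓ]; exact hx
  split_ifs with hf
  · obtain ⟨x, hx⟩ := openSimplex_nonempty hne
    have := (openPolyhedron.isCell O A ℓ ⟨_, hmem x hx⟩).hasEulerChar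
    rw [hrank, ← hAℓ] at this
    convert this using 1
    ext y
    exact and_iff_left_of_imp fun hy => apply_nonpos_of_mem_openSimplex hf hy
  · push Not at hf
    obtain ⟨p, hp, hfp⟩ := hf
    by_cases hx : ∃ x ∈ openSimplex σ, f x ≤ 0
    · obtain ⟨x, hx, hfx⟩ := hx
      obtain ⟨ε, hε, hmove⟩ := exists_lineMap_mem_openSimplex hx hp
      -- The zero of `f` from `x` towards `p` is at `-f x / (f p - f x)`. Adding 1 to numerator and
      -- denominator goes past it but stops short of `p`. Moving by `-ε` away from `p` makes `f`
      -- negative even if `f x = 0`.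
      let s := (1 - f x) / (1 - f x + f p)
      have hden : 0 < 1 - f x + f p := by linarith
      have hs0 : 0 ≤ s := div_nonneg (by linarith) hden.le
      have hs1 : s < 1 := (div_lt_one hden).2 (by linarith)
      let e : (Fin d → ℝ) →ₗ[ℝ] E := (WithLp.linearEquiv 2 ℝ (Fin d → ℝ)).symm
      have := openPolyhedron.hasEulerChar_cut O A ℓ (f.comp e.toAffineMap)
        (hmem _ (hmove (-ε) le_rfl (by linarith))) (hmem _ (hmove s (by linarith) hs1)) ?_ ?_
      · rw [← hAℓ] at this
        exact this
      · change f (AffineMap.lineMap x p (-ε)) < 0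
        rw [AffineMap.apply_lineMap, AffineMap.lineMap_apply_ring']
        nlinarith
      · change 0 < f (AffineMap.lineMap x p s)
        rw [AffineMap.apply_lineMap, AffineMap.lineMap_apply_ring']
        have : s * (f p - f x) + f x = f p / (1 - f x + f p) := by
          simp only [s]; field_simp; ring
        rw [this]
        exact div_pos hfp hden
    · convert HasEulerChar.empty O d using 1
      refine eq_empty_of_forall_notMem fun y hy => hx ⟨_, hy.1, hy.2⟩

theorem openSimplex_subset_convexHull (σ : Finset E) :
    openSimplex σ ⊆ convexHull ℝ (σ : Set E) := by
  rintro x ⟨w, hpos, hw, rfl⟩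
  rw [Finset.mem_convexHull']
  exact ⟨w, fun p hp => (hpos p hp).le, hw, rfl⟩

/-- A common point lies in the convex hull of `σ ∩ τ`. By uniqueness of barycentric coordinates,
every vertex of σ or of τ, having positive weight at that point, belongs to `σ ∩ τ`, so `σ = τ`. -/
theorem openSimplex_disjoint {K : Geometry.SimplicialComplex ℝ E} {σ τ : Finset E}
    (hσ : σ ∈ K.faces) (hτ : τ ∈ K.faces) (h : σ ≠ τ) :
    Disjoint (openSimplex σ) (openSimplex τ) := by
  classical
  refine disjoint_left.2 fun x hxσ hxτ => ?_
  have hx := K.inter_subset_convexHull hσ hτ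
    ⟨openSimplex_subset_convexHull σ hxσ, openSimplex_subset_convexHull τ hxτ⟩
  rw [← Finset.coe_inter, Finset.mem_convexHull'] at hx
  obtain ⟨u, _, hu1, hux⟩ := hx
  have key : ∀ {ρ : Finset E}, ρ ∈ K.faces → σ ∩ τ ⊆ ρ → x ∈ openSimplex ρ → ρ ⊆ σ ∩ τ := by
    rintro ρ hρ hsub ⟨w, hpos, hw1, hwx⟩ p hp
    by_contra hnot
    have := (K.indep hρ).eq_of_sum_eq_sum_subtype (w₁ := w)
      (w₂ := fun q => if q ∈ σ ∩ τ then u q else 0)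
      (by rw [hw1, Finset.sum_ite_mem, Finset.inter_eq_right.2 hsub, hu1])
      (by simp only [ite_smul, zero_smul]
          rw [hwx, Finset.sum_ite_mem, Finset.inter_eq_right.2 hsub, hux]) p hp
    rw [if_neg hnot] at this
    exact (hpos p hp).ne' this
  exact h ((Finset.Subset.antisymm (key hσ Finset.inter_subset_left hxσ)
    Finset.inter_subset_left).trans (Finset.Subset.antisymm Finset.inter_subset_right
      (key hτ Finset.inter_subset_right hxτ)))

end OpenSimplex

/-! ### The Euler curves of a weighted complex -/

namespace WeightedComplex

variable {d : ℕ} (W : WeightedComplex d)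

theorem field_of_mem {σ : Finset (EuclideanSpace ℝ (Fin d))} (hσ : σ ∈ W.complex.faces)
    {x : EuclideanSpace ℝ (Fin d)} (hx : x ∈ openSimplex σ) : W.field x = W.weight σ := by
  rw [WeightedComplex.field, Finset.sum_eq_single_of_mem σ (W.finite_faces.mem_toFinset.2 hσ),
    indicator_of_mem hx]
  intro τ hτ hne
  exact indicator_of_notMem (disjoint_left.1 (openSimplex_disjoint hσ
    (W.finite_faces.mem_toFinset.1 hτ) hne.symm) hx) _

theorem field_nonneg (x : EuclideanSpace ℝ (Fin d)) : 0 ≤ W.field x :=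
  Finset.sum_nonneg fun _ _ => indicator_nonneg (fun _ _ => Nat.cast_nonneg _) _

theorem exists_mem_openSimplex {x : EuclideanSpace ℝ (Fin d)} (hx : 0 < W.field x) :
    ∃ σ ∈ W.complex.faces, x ∈ openSimplex σ := by
  by_contra! h
  refine hx.ne' (Finset.sum_eq_zero fun σ hσ => indicator_of_notMem (h σ ?_) _)
  exact W.finite_faces.mem_toFinset.1 hσ

open Classical in
-- The layer decomposition: σ is present at level `t > 0` exactly when `t ≤ g σ`, and it contributes
-- the Euler characteristic of its part in the half-space.
theorem select_field (O : OMinimalStructure) {v : EuclideanSpace ℝ (Fin d)} (hv : v ≠ 0)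
    (h t : ℝ) : select O W.field v h t = ∑ σ ∈ W.finite_faces.toFinset,
      (Ioc (0 : ℝ) (W.weight σ)).indicator
        (fun _ => if ∀ p ∈ σ, inner ℝ p v ≤ h then (-1 : ℤ) ^ (σ.card - 1) else 0) t := by
  let f : EuclideanSpace ℝ (Fin d) →ᵃ[ℝ] ℝ :=
    (innerₗ (EuclideanSpace ℝ (Fin d)) v).toAffineMap - AffineMap.const ℝ _ h
  have hf : ∀ x, f x = inner ℝ x v - h := fun x => by
    rw [real_inner_comm]; rfl
  have hf' : ∀ x, inner ℝ x v ≤ h ↔ f x ≤ 0 := fun x => by rw [hf, sub_nonpos]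
  refine HasEulerChar.eulerChar_eq ?_
  simp only [hf']
  rcases le_or_gt t 0 with ht | ht
  -- As the field is nonnegative, the set is the whole half-space. It is treated as a cut of the
  -- polyhedron `⊤` with no inequalities; suitable multiples of `v ≠ 0` provide points on both
  -- sides.
  · have h1 : ∀ a : ℝ, t ∉ Ioc 0 a := fun a ha => ht.not_gt ha.1
    have hvv : (0 : ℝ) < inner ℝ v v := real_inner_self_pos.2 hv
    have hval : ∀ a : ℝ, f (((h + a) / inner ℝ v v) • v) = a := fun a => by
      rw [hf, real_inner_smul_left, div_mul_cancel₀ _ hvv.ne']; ring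
    let e : (Fin d → ℝ) →ₗ[ℝ] EuclideanSpace ℝ (Fin d) :=
      (WithLp.linearEquiv 2 ℝ (Fin d → ℝ)).symm
    have := openPolyhedron.hasEulerChar_cut O ⊤ (fun i : Empty => i.elim) (f.comp e.toAffineMap)
      (x₁ := WithLp.ofLp (((h + -1) / inner ℝ v v) • v))
      (x₂ := WithLp.ofLp (((h + 1) / inner ℝ v v) • v)) ⟨trivial, fun i => i.elim⟩
      ⟨trivial, fun i => i.elim⟩ ((hval _).trans_lt (by norm_num))
      ((zero_lt_one' ℝ).trans_eq (hval 1).symm)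
    convert this using 1
    · ext y
      have := ht.trans (W.field_nonneg (WithLp.toLp 2 y))
      simp only [mem_ofPred_eq, this, and_true]
      exact (and_iff_right ⟨trivial, fun i => i.elim⟩).symm
    · simp [h1]
  · have hcell := HasEulerChar.iUnion (O := O) (ι := W.finite_faces.toFinset)
      (X := fun σ => if t ≤ W.weight σ then
        {y : Fin d → ℝ | WithLp.toLp 2 y ∈ openSimplex σ.1 ∧ f (WithLp.toLp 2 y) ≤ 0}
        else ∅)
      (e := fun σ => (Ioc (0 : ℝ) (W.weight σ)).indicator
        (fun _ => if ∀ p ∈ σ.1, f p ≤ 0 then (-1 : ℤ) ^ (σ.1.card - 1) else 0) t)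
      (fun σ => by
        have hσ := W.finite_faces.mem_toFinset.1 σ.2
        by_cases hw : t ≤ W.weight σ
        · rw [if_pos hw, indicator_of_mem (show t ∈ Ioc (0 : ℝ) (W.weight σ) from ⟨ht, hw⟩)]
          exact hasEulerChar_openSimplex_cut O (W.complex.nonempty_of_mem_faces hσ)
            (W.complex.indep hσ) f
        · rw [if_neg hw, indicator_of_notMem fun h : t ∈ Ioc (0 : ℝ) (W.weight σ) => hw h.2]
          exact HasEulerChar.empty O d)
      (fun σ τ hne => by
        have := openSimplex_disjoint (K := W.complex) (W.finite_faces.mem_toFinset.1 σ.2)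
          (W.finite_faces.mem_toFinset.1 τ.2) (Subtype.coe_injective.ne hne)
        dsimp only
        split_ifs
        · exact disjoint_left.2 fun y hy hy' => disjoint_left.1 this hy.1 hy'.1
        all_goals simp)
    rw [Finset.sum_coe_sort W.finite_faces.toFinset (fun σ =>
      (Ioc (0 : ℝ) (W.weight σ)).indicator
        (fun _ => if ∀ p ∈ σ, f p ≤ 0 then (-1 : ℤ) ^ (σ.card - 1) else 0) t)] at hcell
    convert hcell using 1
    ext y
    simp only [mem_ofPred_eq, mem_iUnion]
    constructor
    · rintro ⟨h1, h2⟩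
      obtain ⟨σ, hσ, hy⟩ := W.exists_mem_openSimplex (ht.trans_le h2)
      refine ⟨⟨σ, W.finite_faces.mem_toFinset.2 hσ⟩, ?_⟩
      rw [W.field_of_mem hσ hy] at h2
      rw [if_pos h2]
      exact ⟨hy, h1⟩
    · rintro ⟨σ, hσ⟩
      split_ifs at hσ with hw
      · exact ⟨hσ.2, hw.trans_eq (W.field_of_mem (W.finite_faces.mem_toFinset.1 σ.2) hσ.1).symm⟩
      · exact hσ.elim

open Classical in
theorem weightedEulerCurve_eq_sum (v : EuclideanSpace ℝ (Fin d)) (h : ℝ) :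
    W.weightedEulerCurve v h = ∑ σ ∈ W.finite_faces.toFinset,
      (if ∀ p ∈ σ, inner ℝ p v ≤ h then (-1 : ℤ) ^ (σ.card - 1) else 0) * W.weight σ := by
  have hfaces : (sublevelComplex W.complex v h).faces =
      ↑(W.finite_faces.toFinset.filter fun σ => ∀ p ∈ σ, inner ℝ p v ≤ h) := by
    ext σ; simp [sublevelComplex]
  rw [weightedEulerCurve, weightedEulerChar, hfaces, finsum_mem_coe_finset, Finset.sum_filter]
  exact Finset.sum_congr rfl fun σ _ => by rw [ite_mul, zero_mul]

end WeightedComplex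

end Select

end

/-! ### Integration over the levels -/

theorem mainTheorem4 (O : Select.OMinimalStructure) {d : ℕ} (W : Select.WeightedComplex d)
    (v : EuclideanSpace ℝ (Fin d)) (hv : v ∈ Metric.sphere (0 : EuclideanSpace ℝ (Fin d)) 1)
    (h : ℝ) :
    MeasureTheory.Integrable (fun t : ℝ => (Select.select O W.field v h t : ℝ)) ∧
      Select.marginalEulerCurve O W.field v h = (W.weightedEulerCurve v h : ℝ) := by
  classical
  have hv0 : v ≠ 0 := ne_zero_of_mem_unit_sphere ⟨v, hv⟩
  let c : Finset (EuclideanSpace ℝ (Fin d)) → ℝ := fun σ =>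
    if ∀ p ∈ σ, inner ℝ p v ≤ h then (-1) ^ (σ.card - 1) else 0
  have hsel : (fun t : ℝ => (Select.select O W.field v h t : ℝ)) = fun t =>
      ∑ σ ∈ W.finite_faces.toFinset, (Set.Ioc (0 : ℝ) (W.weight σ)).indicator (fun _ => c σ) t := by
    funext t
    rw [W.select_field O hv0, Int.cast_sum]
    refine Finset.sum_congr rfl fun σ _ => ?_
    simp only [Set.indicator_apply, c]
    push_cast
    rfl
  have hint : ∀ σ ∈ W.finite_faces.toFinset, MeasureTheory.Integrable
      ((Set.Ioc (0 : ℝ) (W.weight σ)).indicator fun _ => c σ) := fun σ _ =>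
    (MeasureTheory.integrable_indicator_iff measurableSet_Ioc).2
      (MeasureTheory.integrableOn_const (by simp))
  refine ⟨hsel ▸ MeasureTheory.integrable_finsetSum _ hint, ?_⟩
  rw [Select.marginalEulerCurve, hsel, MeasureTheory.integral_finsetSum _ hint,
    W.weightedEulerCurve_eq_sum, Int.cast_sum]
  refine Finset.sum_congr rfl fun σ _ => ?_
  -- The interval `(0, g σ]` has length `g σ`, which produces the weight.
  rw [MeasureTheory.integral_indicator_const _ measurableSet_Ioc]
  simp [c, mul_comm]
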